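/- Let $\mathcal M'$ be a connected Riemann surface without boundary, let $\mathcal M\subseteq\mathcal M'$ be closed, and let the boundary $\partial(\mathcal M)$ of $\mathcal M$ be a nonempty closed subset of $\mathcal M'$ with $\mathrm{Fr}(\mathcal M)\subseteq\partial(\mathcal M)\subseteq\mathcal M$, where $\mathrm{Fr}$ is the topological frontier in $\mathcal M'$ (for instance, $\partial(\mathcal M)$ may be a locally finite family of pairwise disjoint closed curves and isolated points). Put $\mathrm{Int}(\mathcal M)=\mathcal M\setminus\partial(\mathcal M)$, and let $\mathbb R^3_1$ be $\mathbb R^3$ with the Lorentzian metric $\langle\,,\rangle=dx_1^2+dx_2^2-dx_3^2$. Let $X:\mathcal M\to\mathbb R^3_1$ be a proper conformal maximal immersion, that is, a proper continuous map that is smooth on $\mathrm{Int}(\mathcal M)$, such that on $\mathrm{Int}(\mathcal M)$ the induced metric is Riemannian (spacelike), is conformal to the complex structure, and $X$ has zero mean curvature; the points of $\partial(\mathcal M)$ may be singular. Suppose that, for some $\alpha\in\,]0,\pi/4[$, there is a compact set $K\subseteq\mathcal M$ such that $X(\mathcal M\setminus K)$ is contained in the conical region $$\mathcal W_\alpha=\{(x,x_3)\in\mathbb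 C\times\mathbb R\equiv\mathbb R^3\;:\;|x_3|\le\|x\|\tan\alpha\}.$$ Then $\mathcal M$ is relative parabolic: every bounded continuous function $f:\mathcal M\to\mathbb R$ that is harmonic on $\mathrm{Int}(\mathcal M)$ and vanishes on $\partial(\mathcal M)$ is identically zero. -/

import Mathlib

open scoped Manifold ContDiff

/-- The Lorentzian metric `dx₁² + dx₂² - dx₃²` on `ℝ³` (coordinates indexed by `0, 1, 2`). -/
def lorentz (v w : EuclideanSpace ℝ (Fin 3)) : ℝ :=
  v 0 * w 0 + v 1 * w 1 - v 2 * w 2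

/-- The Lorentzian vector product, characterized by `⟨v × w, x⟩ = det (v, w, x)`. -/
def lorentzCross (v w : EuclideanSpace ℝ (Fin 3)) : EuclideanSpace ℝ (Fin 3) :=
  !₂[v 1 * w 2 - v 2 * w 1, v 2 * w 0 - v 0 * w 2, -(v 0 * w 1 - v 1 * w 0)]

/-- Partial derivative in the direction `a` of a map on (an open subset of) the plane; the
coordinates are `z = u + i v`, so `a = 1` gives `∂/∂u` and `a = Complex.I` gives `∂/∂v`. -/
noncomputable def pderiv (a : ℂ) (Y : ℂ → EuclideanSpace ℝ (Fin 3)) (z : ℂ) :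
    EuclideanSpace ℝ (Fin 3) :=
  fderiv ℝ Y z a

/-- The induced metric (first fundamental form) of a parametrization `Y`. -/
noncomputable def firstForm (Y : ℂ → EuclideanSpace ℝ (Fin 3)) (z a b : ℂ) : ℝ :=
  lorentz (pderiv a Y z) (pderiv b Y z)

/-- The unit (`⟨N, N⟩ = -1`) normal of a spacelike parametrization `Y`. -/
noncomputable def unitNormal (Y : ℂ → EuclideanSpace ℝ (Fin 3)) (z : ℂ) :
    EuclideanSpace ℝ (Fin 3) :=
  let ν := lorentzCross (pderiv 1 Y z) (pderiv Complex.I Y z)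
  (Real.sqrt (-lorentz ν ν))⁻¹ • ν

/-- The second fundamental form of a spacelike parametrization `Y`. -/
noncomputable def secondForm (Y : ℂ → EuclideanSpace ℝ (Fin 3)) (z a b : ℂ) : ℝ :=
  lorentz (pderiv a (pderiv b Y) z) (unitNormal Y z)

/-- The mean curvature of a spacelike parametrization `Y` (half the trace of the second
fundamental form with respect to the induced metric). -/
noncomputable def meanCurvature (Y : ℂ → EuclideanSpace ℝ (Fin 3)) (z : ℂ) : ℝ :=
  (firstForm Y z 1 1 * secondForm Y z Complex.I Complex.I
      - 2 * firstForm Y z 1 Complex.I * secondForm Y z 1 Complex.I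
      + firstForm Y z Complex.I Complex.I * secondForm Y z 1 1) /
    (2 * (firstForm Y z 1 1 * firstForm Y z Complex.I Complex.I
      - firstForm Y z 1 Complex.I ^ 2))

/-- `M` is a surface with boundary `B`, sitting in the surface without boundary `S`: `M` is closed,
`B` is a closed subset of `M` and contains the topological frontier of `M`. Points of `B` that are
topologically interior to `M` are allowed, since isolated points may be declared boundary points.
The interior of the surface with boundary is `M \ B`, an open subset of `S`. -/
structure IsSurfaceWithBoundary {S : Type*} [TopologicalSpace S] (M B : Set S) : Prop where
  isClosed : IsClosed M
  isClosed_boundary : IsClosed B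
  boundary_subset : B ⊆ M
  frontier_subset : frontier M ⊆ B

/-- `X` is a conformal maximal immersion of the Riemann surface `M` with boundary `B` into
Lorentz-Minkowski space. No condition besides continuity is imposed at boundary points, which
may be singular. -/
structure IsConformalMaximalImmersion {S : Type*} [TopologicalSpace S] [ChartedSpace ℂ S]
    (M B : Set S) (X : S → EuclideanSpace ℝ (Fin 3)) : Prop where
  continuousOn : ContinuousOn X M
  smooth : ContMDiffOn 𝓘(ℝ, ℂ) 𝓘(ℝ, EuclideanSpace ℝ (Fin 3)) ∞ X (M \ B)
  /-- The induced metric on the interior is Riemannian. -/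
  spacelike : ∀ e ∈ atlas ℂ S, ∀ z ∈ e.target ∩ e.symm ⁻¹' (M \ B), ∀ a : ℂ, a ≠ 0 →
    0 < firstForm (X ∘ e.symm) z a a
  /-- Holomorphic coordinates are isothermal. -/
  conformal : ∀ e ∈ atlas ℂ S, ∀ z ∈ e.target ∩ e.symm ⁻¹' (M \ B),
    firstForm (X ∘ e.symm) z 1 1 = firstForm (X ∘ e.symm) z Complex.I Complex.I ∧
      firstForm (X ∘ e.symm) z 1 Complex.I = 0
  maximal : ∀ e ∈ atlas ℂ S, ∀ z ∈ e.target ∩ e.symm ⁻¹' (M \ B),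
    meanCurvature (X ∘ e.symm) z = 0

/-- A real function on a Riemann surface is harmonic on an open set `U`. -/
def IsHarmonicOnSurface {S : Type*} [TopologicalSpace S] [ChartedSpace ℂ S]
    (U : Set S) (f : S → ℝ) : Prop :=
  ∀ e ∈ atlas ℂ S, InnerProductSpace.HarmonicOnNhd (f ∘ e.symm) (e.target ∩ e.symm ⁻¹' U)

/-- The Riemann surface `M` with boundary `B` is relative parabolic: the only bounded harmonic
function (continuous up to the boundary) that vanishes on the boundary is zero. -/
def IsRelativeParabolic {S : Type*} [TopologicalSpace S] [ChartedSpace ℂ S]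
    (M B : Set S) : Prop :=
  ∀ f : S → ℝ, ContinuousOn f M → IsHarmonicOnSurface (M \ B) f →
    (∃ C : ℝ, ∀ p ∈ M, |f p| ≤ C) → (∀ p ∈ B, f p = 0) → ∀ p ∈ M, f p = 0

/-- The conical region `{(x, x₃) ∈ ℂ × ℝ : |x₃| ≤ ‖x‖ tan α}`. -/
def conicalRegion (α : ℝ) : Set (EuclideanSpace ℝ (Fin 3)) :=
  {x | |x 2| ≤ Real.sqrt (x 0 ^ 2 + x 1 ^ 2) * Real.tan α}

/-- A property holds eventually on `M` if it holds outside a compact subset of `M`. -/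
def EventuallyOn {S : Type*} [TopologicalSpace S] (M : Set S) (P : S → Prop) : Prop :=
  ∃ K ⊆ M, IsCompact K ∧ ∀ p ∈ M \ K, P p

/-! The coordinate functions of a maximal surface are harmonic. In an isothermal coordinate with
metric `E (du² + dv²)` this gives `Δ⟨X, X⟩ = 4E`, while `|∇⟨X, X⟩|² ≥ 4E⟨X, X⟩` because the normal
of the surface is timelike. Hence `log ⟨X, X⟩` is superharmonic where `⟨X, X⟩ > 0`, and
`log ⟨X, X⟩ - ⟨X, X⟩⁻¹` strictly so. In the cone `⟨x, x⟩ ≥ cos 2α ‖x‖²`, so by properness this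
function tends to infinity at infinity on the surface.

Now let `f` be bounded, harmonic in the interior and zero on the boundary, and let `s` be such an
exhausting function, strictly superharmonic off a compact set `K`. For `ε > 0` the function
`f - ε s` attains its maximum, necessarily on the boundary or in `K`. Letting `ε → 0`, `f` attains
its maximum on the boundary or in `K`, hence on the boundary by the strong maximum principle and
connectedness. So `f ≤ 0`, and likewise `-f ≤ 0`. -/

open Filter Topology Laplacian InnerProductSpace

/-! ### Second derivatives -/

section SecondDerivatives

variable {E F F' G : Type*} [NormedAddCommGroup E] [NormedSpace ℝ E] [NormedAddCommGroup F]
  [NormedSpace ℝ F] [NormedAddCommGroup F'] [NormedSpace ℝ F'] [NormedAddCommGroup G]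
  [NormedSpace ℝ G] {z : E}

lemma differentiableAt_fderiv_of_contDiffAt_two {g : E → F} (hg : ContDiffAt ℝ 2 g z) :
    DifferentiableAt ℝ (fderiv ℝ g) z :=
  (hg.fderiv_right (m := 1) (by norm_num)).differentiableAt one_ne_zero

lemma eventually_differentiableAt_of_contDiffAt_two {g : E → F} (hg : ContDiffAt ℝ 2 g z) :
    ∀ᶠ w in 𝓝 z, DifferentiableAt ℝ g w :=
  (hg.eventually (by simp)).mono fun _ hw => hw.differentiableAt two_ne_zero

lemma fderiv_fderiv_apply {g : E → F} (hg : DifferentiableAt ℝ (fderiv ℝ g) z) (a b : E) :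
    fderiv ℝ (fun w => fderiv ℝ g w a) z b = fderiv ℝ (fderiv ℝ g) z b a := by
  simp [fderiv_clm_apply hg (differentiableAt_const a)]

lemma fderiv_bilin_apply (β : F →L[ℝ] F' →L[ℝ] G) {u : E → F} {v : E → F'}
    (hu : DifferentiableAt ℝ u z) (hv : DifferentiableAt ℝ v z) (a : E) :
    fderiv ℝ (fun w => β (u w) (v w)) z a =
      β (fderiv ℝ u z a) (v z) + β (u z) (fderiv ℝ v z a) := by
  rw [β.fderiv_of_bilinear hu hv]
  simp [add_comm]

lemma fderiv_fderiv_bilin_self (β : F →L[ℝ] F →L[ℝ] ℝ) {Y : E → F} (hY : ContDiffAt ℝ 2 Y z)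
    (a : E) :
    fderiv ℝ (fderiv ℝ fun w => β (Y w) (Y w)) z a a =
      β (fderiv ℝ (fderiv ℝ Y) z a a) (Y z) + 2 * β (fderiv ℝ Y z a) (fderiv ℝ Y z a) +
        β (Y z) (fderiv ℝ (fderiv ℝ Y) z a a) := by
  have hβY : ContDiffAt ℝ 2 (fun w => β (Y w) (Y w)) z :=
    (β.contDiff.contDiffAt.comp z hY).clm_apply hY
  have hY₀ := eventually_differentiableAt_of_contDiffAt_two hY
  have hY₁ := differentiableAt_fderiv_of_contDiffAt_two hY
  have hYa : DifferentiableAt ℝ (fun w => fderiv ℝ Y w a) z :=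
    hY₁.clm_apply (differentiableAt_const a)
  have hYz := hY₀.self_of_nhds
  have hfirst : (fun w => fderiv ℝ (fun w => β (Y w) (Y w)) w a) =ᶠ[𝓝 z]
      fun w => β (fderiv ℝ Y w a) (Y w) + β (Y w) (fderiv ℝ Y w a) :=
    hY₀.mono fun w hw => fderiv_bilin_apply β hw hw a
  have hleft : DifferentiableAt ℝ (fun w => β (fderiv ℝ Y w a) (Y w)) z :=
    (β.differentiableAt.comp z hYa).clm_apply hYz
  have hright : DifferentiableAt ℝ (fun w => β (Y w) (fderiv ℝ Y w a)) z :=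
    (β.differentiableAt.comp z hYz).clm_apply hYa
  rw [← fderiv_fderiv_apply (differentiableAt_fderiv_of_contDiffAt_two hβY), hfirst.fderiv_eq,
    fderiv_fun_add hleft hright, add_apply, fderiv_bilin_apply β hYa hYz,
    fderiv_bilin_apply β hYz hYa, fderiv_fderiv_apply hY₁]
  ring

lemma fderiv_fderiv_comp_apply {q : E → ℝ} {φ φ' : ℝ → ℝ} {φ'' : ℝ} (hq : ContDiffAt ℝ 2 q z)
    (hφ : ∀ᶠ t in 𝓝 (q z), HasDerivAt φ (φ' t) t) (hφ' : HasDerivAt φ' φ'' (q z)) (a : E) :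
    fderiv ℝ (fderiv ℝ fun w => φ (q w)) z a a =
      φ'' * fderiv ℝ q z a ^ 2 + φ' (q z) * fderiv ℝ (fderiv ℝ q) z a a := by
  have hq₀ := eventually_differentiableAt_of_contDiffAt_two hq
  have hq₁ := differentiableAt_fderiv_of_contDiffAt_two hq
  have hfirst : fderiv ℝ (fun w => φ (q w)) =ᶠ[𝓝 z] fun w => φ' (q w) • fderiv ℝ q w := by
    filter_upwards [hq₀, hq.continuousAt.eventually hφ] with w hw hφw
    exact (hφw.comp_hasFDerivAt w hw.hasFDerivAt).fderiv
  have houter : HasFDerivAt (fun w => φ' (q w)) (φ'' • fderiv ℝ q z) z :=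
    hφ'.comp_hasFDerivAt z hq₀.self_of_nhds.hasFDerivAt
  rw [hfirst.fderiv_eq, (houter.fun_smul hq₁.hasFDerivAt).fderiv]
  simp only [add_apply, smul_apply, ContinuousLinearMap.smulRight_apply, smul_eq_mul]
  ring

lemma deriv_deriv_comp_add_smul {g : E → F} (hg : ContDiffAt ℝ 2 g z) (a : E) :
    deriv (deriv fun t : ℝ => g (z + t • a)) 0 = fderiv ℝ (fderiv ℝ g) z a a := by
  have hline (t : ℝ) : HasDerivAt (fun t : ℝ => z + t • a) a t := by
    simpa using ((hasDerivAt_id t).smul_const a).const_add z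
  have hz : z + (0 : ℝ) • a = z := by simp
  have htendsto : Tendsto (fun t : ℝ => z + t • a) (𝓝 0) (𝓝 z) := by
    simpa only [hz] using (hline 0).continuousAt.tendsto
  have hg₁ := differentiableAt_fderiv_of_contDiffAt_two hg
  have hga : HasFDerivAt (fun w => fderiv ℝ g w a) (fderiv ℝ (fun w => fderiv ℝ g w a) z)
      (z + (0 : ℝ) • a) := by
    rw [hz]
    exact (hg₁.clm_apply (differentiableAt_const a)).hasFDerivAt
  have hfirst : deriv (fun t : ℝ => g (z + t • a)) =ᶠ[𝓝 0] fun t => fderiv ℝ g (z + t • a) a :=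
    (htendsto.eventually (eventually_differentiableAt_of_contDiffAt_two hg)).mono fun t ht =>
      (ht.hasFDerivAt.comp_hasDerivAt t (hline t)).deriv
  rw [hfirst.deriv_eq, ← fderiv_fderiv_apply hg₁]
  exact (hga.comp_hasDerivAt 0 (hline 0)).deriv

lemma deriv_deriv_nonpos_of_isLocalMax {g : ℝ → ℝ} {x : ℝ} (hmax : IsLocalMax g x)
    (hg : ContinuousAt g x) : deriv (deriv g) x ≤ 0 := by
  by_contra! hpos
  have hmin : IsLocalMin g x := isLocalMin_of_deriv_deriv_pos hpos hmax.deriv_eq_zero hg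
  have hconst : g =ᶠ[𝓝 x] fun _ => g x := by
    filter_upwards [hmax, hmin] with t hle hge using le_antisymm hle hge
  rw [hconst.deriv.deriv_eq] at hpos
  simp at hpos

lemma fderiv_fderiv_nonpos_of_isLocalMax {g : E → ℝ} (hmax : IsLocalMax g z)
    (hg : ContDiffAt ℝ 2 g z) (a : E) : fderiv ℝ (fderiv ℝ g) z a a ≤ 0 := by
  rw [← deriv_deriv_comp_add_smul hg a]
  have hz : z + (0 : ℝ) • a = z := by simp
  have hline : ContinuousAt (fun t : ℝ => z + t • a) 0 := by fun_prop
  rw [← hz] at hmax hg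
  exact deriv_deriv_nonpos_of_isLocalMax (IsMaxFilter.comp_tendsto hmax hline)
    (ContinuousAt.comp hg.continuousAt hline)

lemma bilin_fderiv_fderiv_add_eq_zero {β : F →L[ℝ] F →L[ℝ] ℝ} (hβ : ∀ v w, β v w = β w v)
    {Y : E → F} (hY : ContDiffAt ℝ 2 Y z) {a b : E}
    (hnorm : ∀ᶠ w in 𝓝 z, β (fderiv ℝ Y w a) (fderiv ℝ Y w a) =
      β (fderiv ℝ Y w b) (fderiv ℝ Y w b))
    (horth : ∀ᶠ w in 𝓝 z, β (fderiv ℝ Y w a) (fderiv ℝ Y w b) = 0) :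
    β (fderiv ℝ (fderiv ℝ Y) z a a + fderiv ℝ (fderiv ℝ Y) z b b) (fderiv ℝ Y z a) = 0 := by
  -- Differentiate `hnorm` along `a` and `horth` along `b`:
  -- `β(Y_aa, Y_a) = β(Y_ab, Y_b)` and `β(Y_ab, Y_b) + β(Y_a, Y_bb) = 0`.
  have hY₁ := differentiableAt_fderiv_of_contDiffAt_two hY
  have hYd (c : E) : DifferentiableAt ℝ (fun w => fderiv ℝ Y w c) z :=
    hY₁.clm_apply (differentiableAt_const c)
  have hform (c d e : E) : fderiv ℝ (fun w => β (fderiv ℝ Y w c) (fderiv ℝ Y w d)) z e =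
      β (fderiv ℝ (fderiv ℝ Y) z e c) (fderiv ℝ Y z d) +
        β (fderiv ℝ (fderiv ℝ Y) z e d) (fderiv ℝ Y z c) := by
    rw [fderiv_bilin_apply β (hYd c) (hYd d), fderiv_fderiv_apply hY₁, fderiv_fderiv_apply hY₁,
      hβ (fderiv ℝ Y z c)]
  have hsymm : fderiv ℝ (fderiv ℝ Y) z a b = fderiv ℝ (fderiv ℝ Y) z b a :=
    hY.isSymmSndFDerivAt (by simp) a b
  have hnorm_a := congrArg (· a) (EventuallyEq.fderiv_eq (𝕜 := ℝ) hnorm)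
  have horth_b := congrArg (· b) (EventuallyEq.fderiv_eq (𝕜 := ℝ) horth)
  simp only [hform, hsymm, fderiv_fun_const, Pi.zero_apply, zero_apply] at hnorm_a horth_b
  rw [map_add, add_apply]
  linarith

end SecondDerivatives

section Plane

variable {z : ℂ}

lemma laplacian_eq_fderiv_fderiv {F : Type*} [NormedAddCommGroup F] [NormedSpace ℝ F]
    (g : ℂ → F) (z : ℂ) : Δ g z = fderiv ℝ (fderiv ℝ g) z 1 1 +
      fderiv ℝ (fderiv ℝ g) z Complex.I Complex.I := by
  simp [laplacian_eq_iteratedFDeriv_complexPlane, iteratedFDeriv_two_apply]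

lemma laplacian_nonpos_of_isLocalMax {g : ℂ → ℝ} (hmax : IsLocalMax g z)
    (hg : ContDiffAt ℝ 2 g z) : Δ g z ≤ 0 := by
  rw [laplacian_eq_fderiv_fderiv]
  exact add_nonpos (fderiv_fderiv_nonpos_of_isLocalMax hmax hg 1)
    (fderiv_fderiv_nonpos_of_isLocalMax hmax hg Complex.I)

lemma laplacian_comp {q : ℂ → ℝ} {φ φ' : ℝ → ℝ} {φ'' : ℝ} (hq : ContDiffAt ℝ 2 q z)
    (hφ : ∀ᶠ t in 𝓝 (q z), HasDerivAt φ (φ' t) t) (hφ' : HasDerivAt φ' φ'' (q z)) :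
    Δ (fun w => φ (q w)) z =
      φ'' * (fderiv ℝ q z 1 ^ 2 + fderiv ℝ q z Complex.I ^ 2) + φ' (q z) * Δ q z := by
  simp only [laplacian_eq_fderiv_fderiv, fderiv_fderiv_comp_apply hq hφ hφ']
  ring

lemma not_isLocalMax_sub_of_laplacian_neg {f s : ℂ → ℝ} (hf : HarmonicAt f z)
    (hs : ContDiffAt ℝ 2 s z) (hΔ : Δ s z < 0) {ε : ℝ} (hε : 0 < ε) :
    ¬ IsLocalMax (f - ε • s) z := by
  intro hmax
  have hεs : ContDiffAt ℝ 2 (ε • s) z := hs.const_smul ε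
  have hnonpos := laplacian_nonpos_of_isLocalMax hmax (hf.1.sub hεs)
  rw [hf.1.laplacian_sub hεs, laplacian_smul ε hs, hf.2.self_of_nhds, Pi.zero_apply, zero_sub,
    smul_eq_mul] at hnonpos
  linarith [mul_neg_of_pos_of_neg hε hΔ]

lemma eventually_eq_of_isLocalMax_of_harmonicAt {g : ℂ → ℝ} (hg : HarmonicAt g z)
    (hmax : IsLocalMax g z) : ∀ᶠ w in 𝓝 z, g w = g z := by
  -- Locally `g = Re F` with `F` holomorphic, and the maximum principle holds for `|exp F| = exp g`.
  obtain ⟨r, hr, hball⟩ := Metric.eventually_nhds_iff_ball.1 hg.eventually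
  obtain ⟨F, hF, hre⟩ := HarmonicOnNhd.exists_analyticOnNhd_ball_re_eq hball
  have hnhds : Metric.ball z r ∈ 𝓝 z := Metric.ball_mem_nhds z hr
  have hnorm : ∀ w ∈ Metric.ball z r, ‖Complex.exp (F w)‖ = Real.exp (g w) := fun w hw => by
    rw [Complex.norm_exp, ← hre hw]
  have hz := hnorm z (Metric.mem_ball_self hr)
  have hdiff : ∀ᶠ w in 𝓝 z, DifferentiableAt ℂ (fun w => Complex.exp (F w)) w := by
    filter_upwards [hnhds] with w hw using (hF w hw).differentiableAt.cexp
  have hmax_norm : IsLocalMax (norm ∘ fun w => Complex.exp (F w)) z := by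
    filter_upwards [hnhds, hmax] with w hw hle
    simpa only [Function.comp_apply, hnorm w hw, hz] using Real.exp_le_exp.2 hle
  filter_upwards [hnhds, Complex.eventually_eq_of_isLocalMax_norm hdiff hmax_norm] with w hw heq
  apply Real.exp_injective
  rw [← hnorm w hw, ← hz, heq]

end Plane

/-! ### The Lorentzian metric -/

/-- The Lorentzian metric as a continuous bilinear form, which gives access to the calculus of
such forms. -/
noncomputable def lorentzForm :
    EuclideanSpace ℝ (Fin 3) →L[ℝ] EuclideanSpace ℝ (Fin 3) →L[ℝ] ℝ :=
  let coord (i : Fin 3) : EuclideanSpace ℝ (Fin 3) →L[ℝ] ℝ := EuclideanSpace.proj i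
  (coord 0).smulRight (coord 0) + (coord 1).smulRight (coord 1) - (coord 2).smulRight (coord 2)

lemma lorentzForm_apply (v w : EuclideanSpace ℝ (Fin 3)) : lorentzForm v w = lorentz v w := by
  simp [lorentzForm, lorentz]

lemma lorentz_comm (v w : EuclideanSpace ℝ (Fin 3)) : lorentz v w = lorentz w v := by
  simp only [lorentz]
  ring

lemma continuous_lorentz_self : Continuous fun x => lorentz x x := by
  unfold lorentz
  fun_prop

lemma lorentz_lorentzCross_self (a b : EuclideanSpace ℝ (Fin 3)) :
    lorentz (lorentzCross a b) (lorentzCross a b) =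
      -(lorentz a a * lorentz b b - lorentz a b ^ 2) := by
  simp only [lorentz, lorentzCross, Matrix.cons_val_zero, Matrix.cons_val_one, Matrix.cons_val]
  ring

lemma gram_smul_eq (a b w : EuclideanSpace ℝ (Fin 3)) :
    (lorentz a a * lorentz b b - lorentz a b ^ 2) • w =
      (lorentz b b * lorentz w a - lorentz a b * lorentz w b) • a +
      (lorentz a a * lorentz w b - lorentz a b * lorentz w a) • b -
      lorentz w (lorentzCross a b) • lorentzCross a b := by
  ext i
  simp only [PiLp.smul_apply, PiLp.sub_apply, PiLp.add_apply, smul_eq_mul, lorentz, lorentzCross]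
  fin_cases i <;>
    simp only [Fin.zero_eta, Fin.mk_one, Fin.reduceFinMk, Matrix.cons_val_zero,
      Matrix.cons_val_one, Matrix.cons_val] <;>
    ring

lemma eq_zero_of_lorentz_eq_zero {a b w : EuclideanSpace ℝ (Fin 3)}
    (hgram : lorentz a a * lorentz b b - lorentz a b ^ 2 ≠ 0) (ha : lorentz w a = 0)
    (hb : lorentz w b = 0) (hcross : lorentz w (lorentzCross a b) = 0) : w = 0 := by
  simpa [ha, hb, hcross, hgram] using gram_smul_eq a b w

lemma lorentz_self_mul_le {a b : EuclideanSpace ℝ (Fin 3)} (hnorm : lorentz a a = lorentz b b)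
    (horth : lorentz a b = 0) (hpos : 0 < lorentz a a) (x : EuclideanSpace ℝ (Fin 3)) :
    lorentz a a * lorentz x x ≤ lorentz x a ^ 2 + lorentz x b ^ 2 := by
  -- The normal direction is timelike, so it contributes negatively to `⟨x, x⟩`.
  have hexpand := congrArg (lorentzForm x) (gram_smul_eq a b x)
  simp only [map_add, map_sub, map_smul, smul_eq_mul, lorentzForm_apply, ← hnorm, horth] at hexpand
  refine le_of_mul_le_mul_left ?_ hpos
  nlinarith [sq_nonneg (lorentz x (lorentzCross a b))]

lemma cos_two_mul_mul_norm_sq_le_lorentz {α : ℝ} (hα : Real.cos α ≠ 0)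
    {x : EuclideanSpace ℝ (Fin 3)} (hx : x ∈ conicalRegion α) :
    Real.cos (2 * α) * ‖x‖ ^ 2 ≤ lorentz x x := by
  have hsq : x 2 ^ 2 ≤ (x 0 ^ 2 + x 1 ^ 2) * Real.tan α ^ 2 := by
    have h : |x 2| ^ 2 ≤ (Real.sqrt (x 0 ^ 2 + x 1 ^ 2) * Real.tan α) ^ 2 :=
      pow_le_pow_left₀ (abs_nonneg _) hx 2
    rwa [sq_abs, mul_pow, Real.sq_sqrt (by positivity)] at h
  have hcone : Real.cos α ^ 2 * x 2 ^ 2 ≤ (x 0 ^ 2 + x 1 ^ 2) * (1 - Real.cos α ^ 2) := by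
    calc Real.cos α ^ 2 * x 2 ^ 2
        ≤ Real.cos α ^ 2 * ((x 0 ^ 2 + x 1 ^ 2) * Real.tan α ^ 2) := by gcongr
      _ = (x 0 ^ 2 + x 1 ^ 2) * (Real.tan α * Real.cos α) ^ 2 := by ring
      _ = (x 0 ^ 2 + x 1 ^ 2) * (1 - Real.cos α ^ 2) := by
        rw [Real.tan_mul_cos hα, Real.sin_sq]
  rw [EuclideanSpace.real_norm_sq_eq, Fin.sum_univ_three, lorentz, Real.cos_two_mul]
  linarith

/-! ### Maximal surfaces in isothermal coordinates -/

/-- The coordinate of the parametrization `Y` is isothermal at `z`: the induced metric is a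
multiple of `du² + dv²` there. -/
def IsIsothermalAt (Y : ℂ → EuclideanSpace ℝ (Fin 3)) (z : ℂ) : Prop :=
  firstForm Y z 1 1 = firstForm Y z Complex.I Complex.I ∧ firstForm Y z 1 Complex.I = 0

section Isothermal

variable {Y : ℂ → EuclideanSpace ℝ (Fin 3)} {z : ℂ}

lemma pderiv_pderiv (hY : ContDiffAt ℝ 2 Y z) (a b : ℂ) :
    pderiv a (pderiv b Y) z = fderiv ℝ (fderiv ℝ Y) z a b :=
  fderiv_fderiv_apply (differentiableAt_fderiv_of_contDiffAt_two hY) b a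

lemma lorentz_laplacian_pderiv_eq_zero (hY : ContDiffAt ℝ 2 Y z)
    (hiso : ∀ᶠ w in 𝓝 z, IsIsothermalAt Y w) :
    lorentz (Δ Y z) (pderiv 1 Y z) = 0 ∧ lorentz (Δ Y z) (pderiv Complex.I Y z) = 0 := by
  have hsymm (v w) : lorentzForm v w = lorentzForm w v := by
    simp only [lorentzForm_apply, lorentz_comm v]
  simp only [IsIsothermalAt, firstForm, pderiv, ← lorentzForm_apply] at hiso
  simp only [← lorentzForm_apply, laplacian_eq_fderiv_fderiv]
  refine ⟨bilin_fderiv_fderiv_add_eq_zero hsymm hY (hiso.mono fun _ h => h.1)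
    (hiso.mono fun _ h => h.2), ?_⟩
  rw [add_comm]
  exact bilin_fderiv_fderiv_add_eq_zero hsymm hY (hiso.mono fun _ h => h.1.symm)
    (hiso.mono fun _ h => hsymm _ _ ▸ h.2)

lemma IsIsothermalAt.meanCurvature_eq (hiso : IsIsothermalAt Y z) (hY : ContDiffAt ℝ 2 Y z)
    (hpos : 0 < firstForm Y z 1 1) :
    meanCurvature Y z = lorentz (Δ Y z) (unitNormal Y z) / (2 * firstForm Y z 1 1) := by
  have hE := hpos.ne'
  simp only [meanCurvature, secondForm, pderiv_pderiv hY, ← hiso.1, hiso.2,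
    laplacian_eq_fderiv_fderiv, ← lorentzForm_apply, map_add, add_apply]
  field_simp
  ring

lemma laplacian_eq_zero_of_meanCurvature_eq_zero (hY : ContDiffAt ℝ 2 Y z)
    (hpos : 0 < firstForm Y z 1 1) (hiso : ∀ᶠ w in 𝓝 z, IsIsothermalAt Y w)
    (hmean : meanCurvature Y z = 0) : Δ Y z = 0 := by
  obtain ⟨htangent₁, htangent₂⟩ := lorentz_laplacian_pderiv_eq_zero hY hiso
  have hiso_z := hiso.self_of_nhds
  have hgram : 0 < lorentz (pderiv 1 Y z) (pderiv 1 Y z) *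
      lorentz (pderiv Complex.I Y z) (pderiv Complex.I Y z) -
        lorentz (pderiv 1 Y z) (pderiv Complex.I Y z) ^ 2 := by
    change 0 < firstForm Y z 1 1 * firstForm Y z Complex.I Complex.I -
      firstForm Y z 1 Complex.I ^ 2
    rw [← hiso_z.1, hiso_z.2]
    nlinarith
  refine eq_zero_of_lorentz_eq_zero hgram.ne' htangent₁ htangent₂ ?_
  have hnormal : lorentz (Δ Y z) (unitNormal Y z) = 0 := by
    rw [hiso_z.meanCurvature_eq hY hpos, div_eq_zero_iff] at hmean
    exact hmean.resolve_right (by positivity)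
  rw [unitNormal, ← lorentzForm_apply, map_smul, smul_eq_mul, lorentzForm_apply,
    lorentz_lorentzCross_self, neg_neg] at hnormal
  exact (mul_eq_zero.1 hnormal).resolve_left (inv_ne_zero (Real.sqrt_ne_zero'.2 hgram))

lemma contDiffAt_lorentz_self (hY : ContDiffAt ℝ 2 Y z) :
    ContDiffAt ℝ 2 (fun w => lorentz (Y w) (Y w)) z := by
  simp only [← lorentzForm_apply]
  exact (lorentzForm.contDiff.contDiffAt.comp z hY).clm_apply hY

lemma fderiv_lorentz_self (hY : DifferentiableAt ℝ Y z) (a : ℂ) :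
    fderiv ℝ (fun w => lorentz (Y w) (Y w)) z a = 2 * lorentz (Y z) (pderiv a Y z) := by
  simp only [← lorentzForm_apply]
  rw [fderiv_bilin_apply lorentzForm hY hY, ← pderiv]
  simp only [lorentzForm_apply, lorentz_comm (pderiv a Y z)]
  ring

lemma laplacian_lorentz_self (hY : ContDiffAt ℝ 2 Y z) :
    Δ (fun w => lorentz (Y w) (Y w)) z = 2 * lorentz (Δ Y z) (Y z) +
      2 * (firstForm Y z 1 1 + firstForm Y z Complex.I Complex.I) := by
  have hsymm (v) : lorentzForm (Y z) v = lorentzForm v (Y z) := by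
    simp only [lorentzForm_apply, lorentz_comm v]
  simp only [firstForm, pderiv, ← lorentzForm_apply]
  simp only [laplacian_eq_fderiv_fderiv, fderiv_fderiv_bilin_self lorentzForm hY, hsymm, map_add,
    add_apply]
  ring

end Isothermal

/-- The profile `φ` of the barrier `φ ⟨X, X⟩`. On a maximal surface `φ ⟨X, X⟩` is strictly
superharmonic where `⟨X, X⟩ > 0` as soon as `φ'' < 0` and `(t φ')' < 0`. The logarithm is the
borderline case `(t φ')' = 0`, and the term `- t⁻¹` makes the inequality strict. -/
noncomputable def logSubInv (t : ℝ) : ℝ := Real.log t - t⁻¹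

section LogSubInv

variable {t : ℝ}

lemma hasDerivAt_logSubInv (ht : t ≠ 0) : HasDerivAt logSubInv (t⁻¹ + (t ^ 2)⁻¹) t := by
  exact ((Real.hasDerivAt_log ht).fun_sub (hasDerivAt_inv ht)).congr_deriv (by ring)

lemma hasDerivAt_deriv_logSubInv (ht : t ≠ 0) :
    HasDerivAt (fun t => t⁻¹ + (t ^ 2)⁻¹) (-(t ^ 2)⁻¹ - 2 * (t ^ 3)⁻¹) t := by
  refine ((hasDerivAt_inv ht).fun_add
    ((hasDerivAt_pow 2 t).fun_inv (pow_ne_zero 2 ht))).congr_deriv ?_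
  field_simp
  ring

lemma contDiffAt_logSubInv (ht : t ≠ 0) {n : WithTop ℕ∞} : ContDiffAt ℝ n logSubInv t :=
  (Real.contDiffAt_log.2 ht).sub (contDiffAt_inv ℝ ht)

lemma tendsto_logSubInv_atTop : Tendsto logSubInv atTop atTop := by
  exact (Real.tendsto_log_atTop.atTop_add tendsto_inv_atTop_zero.neg).congr fun t =>
    (sub_eq_add_neg _ _).symm

end LogSubInv

lemma laplacian_logSubInv_lorentz_self_neg {Y : ℂ → EuclideanSpace ℝ (Fin 3)} {z : ℂ}
    (hY : ContDiffAt ℝ 2 Y z) (hiso : IsIsothermalAt Y z) (hpos : 0 < firstForm Y z 1 1)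
    (hharm : Δ Y z = 0) (hq : 0 < lorentz (Y z) (Y z)) :
    Δ (fun w => logSubInv (lorentz (Y w) (Y w))) z < 0 := by
  have hYz : DifferentiableAt ℝ Y z := hY.differentiableAt two_ne_zero
  have hΔq : Δ (fun w => lorentz (Y w) (Y w)) z = 4 * firstForm Y z 1 1 := by
    rw [laplacian_lorentz_self hY, hharm, ← hiso.1, ← lorentzForm_apply, map_zero, zero_apply]
    ring
  have hgrad : firstForm Y z 1 1 * lorentz (Y z) (Y z) ≤
      lorentz (Y z) (pderiv 1 Y z) ^ 2 + lorentz (Y z) (pderiv Complex.I Y z) ^ 2 :=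
    lorentz_self_mul_le hiso.1 hiso.2 hpos (Y z)
  rw [laplacian_comp (contDiffAt_lorentz_self hY)
    ((eventually_ne_nhds hq.ne').mono fun t ht => hasDerivAt_logSubInv ht)
    (hasDerivAt_deriv_logSubInv hq.ne'), hΔq, fderiv_lorentz_self hYz, fderiv_lorentz_self hYz]
  set E := firstForm Y z 1 1
  set q := lorentz (Y z) (Y z)
  set u := lorentz (Y z) (pderiv 1 Y z)
  set v := lorentz (Y z) (pderiv Complex.I Y z)
  have hφ'' : -(q ^ 2)⁻¹ - 2 * (q ^ 3)⁻¹ ≤ 0 := by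
    have : 0 < (q ^ 2)⁻¹ + 2 * (q ^ 3)⁻¹ := by positivity
    linarith
  calc (-(q ^ 2)⁻¹ - 2 * (q ^ 3)⁻¹) * ((2 * u) ^ 2 + (2 * v) ^ 2) + (q⁻¹ + (q ^ 2)⁻¹) * (4 * E)
      = (-(q ^ 2)⁻¹ - 2 * (q ^ 3)⁻¹) * (4 * (u ^ 2 + v ^ 2)) + (q⁻¹ + (q ^ 2)⁻¹) * (4 * E) := by
        ring
    _ ≤ (-(q ^ 2)⁻¹ - 2 * (q ^ 3)⁻¹) * (4 * (E * q)) + (q⁻¹ + (q ^ 2)⁻¹) * (4 * E) := by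
        gcongr ?_ + _
        exact mul_le_mul_of_nonpos_left (by linarith) hφ''
    _ = -(4 * E / q ^ 2) := by
        field_simp
        ring
    _ < 0 := neg_neg_of_pos (by positivity)

/-- The barrier as a function on Lorentz-Minkowski space. Truncating `⟨x, x⟩` at `1` keeps it
continuous on the whole space. -/
noncomputable def lorentzBarrier (x : EuclideanSpace ℝ (Fin 3)) : ℝ :=
  logSubInv (max 1 (lorentz x x))

lemma continuous_lorentzBarrier : Continuous lorentzBarrier := by
  have hpos (x : EuclideanSpace ℝ (Fin 3)) : max 1 (lorentz x x) ≠ 0 :=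
    (one_pos.trans_le (le_max_left _ _)).ne'
  have hmax : Continuous fun x => max 1 (lorentz x x) :=
    continuous_const.max continuous_lorentz_self
  exact (hmax.log hpos).sub (hmax.inv₀ hpos)

lemma lorentzBarrier_eventuallyEq {x : EuclideanSpace ℝ (Fin 3)} (hx : 1 < lorentz x x) :
    lorentzBarrier =ᶠ[𝓝 x] fun y => logSubInv (lorentz y y) :=
  (continuous_lorentz_self.continuousAt.eventually (lt_mem_nhds hx)).mono fun y hy => by
    rw [lorentzBarrier, max_eq_right hy.le]

/-! ### Maximum principles on Riemann surfaces with boundary -/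

section Surface

variable {S : Type*} [TopologicalSpace S] {M B : Set S}

lemma IsSurfaceWithBoundary.isOpen_sdiff (hM : IsSurfaceWithBoundary M B) : IsOpen (M \ B) := by
  have hinterior : M \ B = interior M \ B := by
    rw [← self_sdiff_frontier, Set.sdiff_sdiff, Set.union_eq_self_of_subset_left hM.frontier_subset]
  rw [hinterior]
  exact isOpen_interior.sdiff hM.isClosed_boundary

lemma IsSurfaceWithBoundary.isLocalMax_of_isMaxOn (hM : IsSurfaceWithBoundary M B) {f : S → ℝ}
    {p : S} (hp : p ∈ M \ B) (hmax : IsMaxOn f M p) : IsLocalMax f p :=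
  hmax.isLocalMax (mem_of_superset (hM.isOpen_sdiff.mem_nhds hp) Set.sdiff_subset)

variable [ChartedSpace ℂ S]

/-- A real function on a Riemann surface is of class `C²` with negative Laplacian on `U`. The
sign of the Laplacian does not depend on the holomorphic coordinate, and it is tested in the
preferred chart at each point. -/
def IsStrictlySuperharmonicOnSurface (U : Set S) (s : S → ℝ) : Prop :=
  ∀ p ∈ U, ContDiffAt ℝ 2 (s ∘ (chartAt ℂ p).symm) (chartAt ℂ p p) ∧
    Δ (s ∘ (chartAt ℂ p).symm) (chartAt ℂ p p) < 0

lemma continuousAt_chartAt_symm (p : S) :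
    ContinuousAt (chartAt ℂ p).symm (chartAt ℂ p p) :=
  (chartAt ℂ p).continuousAt_symm (mem_chart_target ℂ p)

lemma chartAt_symm_chartAt (p : S) : (chartAt ℂ p).symm (chartAt ℂ p p) = p :=
  (chartAt ℂ p).left_inv (mem_chart_source ℂ p)

lemma isLocalMax_comp_chartAt_symm {g : S → ℝ} {p : S} (hmax : IsLocalMax g p) :
    IsLocalMax (g ∘ (chartAt ℂ p).symm) (chartAt ℂ p p) :=
  IsMaxFilter.comp_tendsto (by rwa [chartAt_symm_chartAt]) (continuousAt_chartAt_symm p)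

namespace IsHarmonicOnSurface

variable {U : Set S} {f : S → ℝ}

lemma neg (hf : IsHarmonicOnSurface U f) : IsHarmonicOnSurface U (-f) :=
  fun e he => (hf e he).neg

lemma harmonicAt (hf : IsHarmonicOnSurface U f) {p : S} (hp : p ∈ U) :
    HarmonicAt (f ∘ (chartAt ℂ p).symm) (chartAt ℂ p p) :=
  hf _ (chart_mem_atlas ℂ p) _ ⟨mem_chart_target ℂ p, by simpa using hp⟩

lemma eventually_eq_of_isLocalMax (hf : IsHarmonicOnSurface U f) {p : S} (hp : p ∈ U)
    (hmax : IsLocalMax f p) : ∀ᶠ x in 𝓝 p, f x = f p := by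
  have hchart := eventually_eq_of_isLocalMax_of_harmonicAt (hf.harmonicAt hp)
    (isLocalMax_comp_chartAt_symm hmax)
  have hcont := (chartAt ℂ p).continuousAt (mem_chart_source ℂ p)
  filter_upwards [hcont.eventually hchart, chart_source_mem_nhds ℂ p] with x hx hxs
  simpa [(chartAt ℂ p).left_inv hxs] using hx

lemma not_isLocalMax_sub (hf : IsHarmonicOnSurface U f) {V : Set S} {s : S → ℝ}
    (hs : IsStrictlySuperharmonicOnSurface V s) {ε : ℝ} (hε : 0 < ε) {p : S} (hpU : p ∈ U)
    (hpV : p ∈ V) : ¬ IsLocalMax (f - ε • s) p := fun hmax =>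
  not_isLocalMax_sub_of_laplacian_neg (hf.harmonicAt hpU) (hs p hpV).1 (hs p hpV).2 hε
    (isLocalMax_comp_chartAt_symm hmax)

lemma exists_boundary_eq_of_isMaxOn [ConnectedSpace S] (hM : IsSurfaceWithBoundary M B)
    (hB : B.Nonempty) (hfc : ContinuousOn f M) (hf : IsHarmonicOnSurface (M \ B) f) {p : S}
    (hp : p ∈ M) (hmax : IsMaxOn f M p) : ∃ b ∈ B, f b = f p := by
  by_contra! hne
  have hsub : M ∩ f ⁻¹' {f p} ⊆ M \ B := fun x hx => ⟨hx.1, fun hxB => hne x hxB hx.2⟩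
  have hclosed : IsClosed (M ∩ f ⁻¹' {f p}) :=
    hfc.preimage_isClosed_of_isClosed hM.isClosed isClosed_singleton
  have hopen : IsOpen (M ∩ f ⁻¹' {f p}) := by
    refine isOpen_iff_mem_nhds.2 fun x hx => ?_
    have hxp : f x = f p := hx.2
    have hxmax : IsMaxOn f M x := fun y hy => (hmax hy).trans_eq hxp.symm
    filter_upwards [hM.isOpen_sdiff.mem_nhds (hsub hx), hf.eventually_eq_of_isLocalMax (hsub hx)
      (hM.isLocalMax_of_isMaxOn (hsub hx) hxmax)] with y hy hyx
    exact ⟨hy.1, hyx.trans hxp⟩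
  have huniv : M ∩ f ⁻¹' {f p} = Set.univ := IsClopen.eq_univ ⟨hclosed, hopen⟩ ⟨p, hp, rfl⟩
  obtain ⟨b, hb⟩ := hB
  exact (hsub (huniv ▸ Set.mem_univ b)).2 hb

end IsHarmonicOnSurface

section Khasminskii

variable {K : Set S} {f s : S → ℝ}

lemma exists_isMaxOn_sub_of_strictlySuperharmonic (hM : IsSurfaceWithBoundary M B)
    (hMne : M.Nonempty) (hsc : ContinuousOn s M)
    (hs : IsStrictlySuperharmonicOnSurface (M \ (B ∪ K)) s)
    (htop : Tendsto s (cocompact S ⊓ 𝓟 M) atTop) (hfc : ContinuousOn f M)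
    (hf : IsHarmonicOnSurface (M \ B) f) {C : ℝ} (hC : ∀ p ∈ M, f p ≤ C) {ε : ℝ} (hε : 0 < ε) :
    ∃ p ∈ M ∩ (B ∪ K), IsMaxOn (f - ε • s) M p := by
  obtain ⟨p₀, hp₀⟩ := hMne
  have hfar : ∀ᶠ p in cocompact S ⊓ 𝓟 M, (f - ε • s) p ≤ (f - ε • s) p₀ := by
    filter_upwards [htop.eventually_ge_atTop ((C - (f - ε • s) p₀) / ε),
      mem_inf_of_right (mem_principal_self M)] with p hp hpM
    rw [div_le_iff₀' hε] at hp
    change f p - ε * s p ≤ _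
    linarith [hC p hpM]
  obtain ⟨p, hp, hmax⟩ :=
    (hfc.sub (hsc.const_smul ε)).exists_isMaxOn' hM.isClosed hp₀ hfar
  refine ⟨p, ⟨hp, ?_⟩, hmax⟩
  by_contra hpBK
  have hpB : p ∈ M \ B := ⟨hp, fun h => hpBK (Or.inl h)⟩
  exact hf.not_isLocalMax_sub hs hε hpB ⟨hp, hpBK⟩ (hM.isLocalMax_of_isMaxOn hpB hmax)

lemma le_of_le_of_strictlySuperharmonic (hM : IsSurfaceWithBoundary M B)
    (hsc : ContinuousOn s M) (hs : IsStrictlySuperharmonicOnSurface (M \ (B ∪ K)) s)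
    (htop : Tendsto s (cocompact S ⊓ 𝓟 M) atTop) (hfc : ContinuousOn f M)
    (hf : IsHarmonicOnSurface (M \ B) f) {C : ℝ} (hC : ∀ p ∈ M, f p ≤ C) {m : ℝ}
    (hm : ∀ p ∈ M ∩ (B ∪ K), f p ≤ m) : ∀ p ∈ M, f p ≤ m := by
  intro x hx
  obtain ⟨y, -, hy⟩ := hsc.exists_isMinOn' hM.isClosed hx (htop.eventually_ge_atTop (s x))
  have hle : ∀ ε > 0, f x ≤ m + ε * (s x - s y) := fun ε hε => by
    obtain ⟨p, hp, hmax⟩ :=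
      exists_isMaxOn_sub_of_strictlySuperharmonic hM ⟨x, hx⟩ hsc hs htop hfc hf hC hε
    have hxp : f x - ε * s x ≤ f p - ε * s p := hmax hx
    have hyp : ε * s y ≤ ε * s p := mul_le_mul_of_nonneg_left (hy hp.1) hε.le
    linarith [hm p hp]
  have hlim : Tendsto (fun ε => m + ε * (s x - s y)) (𝓝[>] 0) (𝓝 m) :=
    ((by fun_prop : Continuous fun ε => m + ε * (s x - s y)).tendsto' 0 m (by simp)).mono_left
      nhdsWithin_le_nhds
  exact ge_of_tendsto hlim (eventually_mem_nhdsWithin.mono hle)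

lemma nonpos_of_strictlySuperharmonic [ConnectedSpace S] (hM : IsSurfaceWithBoundary M B)
    (hB : B.Nonempty) (hK : IsCompact K) (hKM : K ⊆ M) (hsc : ContinuousOn s M)
    (hs : IsStrictlySuperharmonicOnSurface (M \ (B ∪ K)) s)
    (htop : Tendsto s (cocompact S ⊓ 𝓟 M) atTop) (hfc : ContinuousOn f M)
    (hf : IsHarmonicOnSurface (M \ B) f) {C : ℝ} (hC : ∀ p ∈ M, f p ≤ C)
    (hfB : ∀ p ∈ B, f p = 0) : ∀ p ∈ M, f p ≤ 0 := by
  obtain ⟨b, hb⟩ := hB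
  have hKbM : insert b K ⊆ M := Set.insert_subset (hM.boundary_subset hb) hKM
  obtain ⟨x, hx, hxmax⟩ :=
    (hK.insert b).exists_isMaxOn (Set.insert_nonempty b K) (hfc.mono hKbM)
  have hglobal : IsMaxOn f M x := by
    refine le_of_le_of_strictlySuperharmonic hM hsc hs htop hfc hf hC ?_
    rintro p ⟨-, hpB | hpK⟩
    · rw [hfB p hpB, ← hfB b hb]
      exact hxmax (Set.mem_insert b K)
    · exact hxmax (Set.mem_insert_of_mem b hpK)
  obtain ⟨b', hb', hb'x⟩ := hf.exists_boundary_eq_of_isMaxOn hM ⟨b, hb⟩ hfc (hKbM hx) hglobal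
  exact fun p hp => (hglobal hp).trans_eq (hb'x.symm.trans (hfB b' hb'))

theorem isRelativeParabolic_of_strictlySuperharmonic [ConnectedSpace S]
    (hM : IsSurfaceWithBoundary M B) (hB : B.Nonempty) (hK : IsCompact K) (hKM : K ⊆ M)
    (hsc : ContinuousOn s M) (hs : IsStrictlySuperharmonicOnSurface (M \ (B ∪ K)) s)
    (htop : Tendsto s (cocompact S ⊓ 𝓟 M) atTop) : IsRelativeParabolic M B := by
  intro f hfc hf ⟨C, hC⟩ hfB p hp
  refine le_antisymm ?_ (neg_nonpos.1 ?_)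
  · exact nonpos_of_strictlySuperharmonic hM hB hK hKM hsc hs htop hfc hf
      (fun x hx => (le_abs_self _).trans (hC x hx)) hfB p hp
  · exact nonpos_of_strictlySuperharmonic hM hB hK hKM hsc hs htop hfc.neg hf.neg
      (fun x hx => (neg_le_abs _).trans (hC x hx)) (fun x hx => by simp [hfB x hx]) p hp

end Khasminskii

/-! ### Conformal maximal immersions -/

variable {X : S → EuclideanSpace ℝ (Fin 3)}

namespace IsConformalMaximalImmersion

variable (hM : IsSurfaceWithBoundary M B) (hX : IsConformalMaximalImmersion M B X)
include hM hX

lemma contDiffAt_comp_chartAt_symm {p : S} (hp : p ∈ M \ B) :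
    ContDiffAt ℝ 2 (X ∘ (chartAt ℂ p).symm) (chartAt ℂ p p) := by
  have hsmooth := (contMDiffAt_iff.1 ((hX.smooth p hp).contMDiffAt
    (hM.isOpen_sdiff.mem_nhds hp))).2
  simp only [mfld_simps, contDiffWithinAt_univ] at hsmooth
  exact hsmooth.of_le (by norm_cast)

lemma laplacian_comp_chartAt_symm_eq_zero {p : S} (hp : p ∈ M \ B) :
    Δ (X ∘ (chartAt ℂ p).symm) (chartAt ℂ p p) = 0 := by
  have hatlas := chart_mem_atlas ℂ p
  have hmem : chartAt ℂ p p ∈ (chartAt ℂ p).target ∩ (chartAt ℂ p).symm ⁻¹' (M \ B) :=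
    ⟨mem_chart_target ℂ p, by simpa using hp⟩
  have hnhds := ((chartAt ℂ p).isOpen_inter_preimage_symm hM.isOpen_sdiff).mem_nhds hmem
  exact laplacian_eq_zero_of_meanCurvature_eq_zero (contDiffAt_comp_chartAt_symm hM hX hp)
    (hX.spacelike _ hatlas _ hmem 1 one_ne_zero)
    (mem_of_superset hnhds (hX.conformal _ hatlas)) (hX.maximal _ hatlas _ hmem)

lemma isStrictlySuperharmonicOnSurface_lorentzBarrier :
    IsStrictlySuperharmonicOnSurface {p ∈ M \ B | 1 < lorentz (X p) (X p)}
      (lorentzBarrier ∘ X) := by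
  rintro p ⟨hp, hq⟩
  have hatlas := chart_mem_atlas ℂ p
  have hmem : chartAt ℂ p p ∈ (chartAt ℂ p).target ∩ (chartAt ℂ p).symm ⁻¹' (M \ B) :=
    ⟨mem_chart_target ℂ p, by simpa using hp⟩
  have hY := contDiffAt_comp_chartAt_symm hM hX hp
  have hYp : (X ∘ (chartAt ℂ p).symm) (chartAt ℂ p p) = X p :=
    congrArg X (chartAt_symm_chartAt p)
  rw [← hYp] at hq
  have hq₀ := one_pos.trans hq
  have hbarrier : (lorentzBarrier ∘ X) ∘ (chartAt ℂ p).symm =ᶠ[𝓝 (chartAt ℂ p p)]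
      fun w => logSubInv (lorentz ((X ∘ (chartAt ℂ p).symm) w) ((X ∘ (chartAt ℂ p).symm) w)) :=
    hY.continuousAt.eventually (lorentzBarrier_eventuallyEq hq)
  refine ⟨ContDiffAt.congr_of_eventuallyEq ?_ hbarrier, ?_⟩
  · exact ContDiffAt.comp (chartAt ℂ p p) (contDiffAt_logSubInv hq₀.ne')
      (contDiffAt_lorentz_self hY)
  · rw [(laplacian_congr_nhds hbarrier).self_of_nhds]
    exact laplacian_logSubInv_lorentz_self_neg hY (hX.conformal _ hatlas _ hmem)
      (hX.spacelike _ hatlas _ hmem 1 one_ne_zero)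
      (laplacian_comp_chartAt_symm_eq_zero hM hX hp) hq₀

end IsConformalMaximalImmersion

end Surface

lemma tendsto_lorentz_self_atTop {S : Type*} [TopologicalSpace S] {M : Set S}
    {X : S → EuclideanSpace ℝ (Fin 3)} (hproper : IsProperMap (M.domRestrict X)) {α : ℝ}
    (hα : 0 < Real.cos (2 * α)) (hcone : EventuallyOn M (fun p => X p ∈ conicalRegion α)) :
    Tendsto (fun p => lorentz (X p) (X p)) (cocompact S ⊓ 𝓟 M) atTop := by
  have hcos : Real.cos α ≠ 0 := fun h => by
    rw [Real.cos_two_mul, h] at hα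
    norm_num at hα
  have hX : Tendsto X (cocompact S ⊓ 𝓟 M) (cocompact _) := by
    rw [← Subtype.range_coe (s := M), ← map_comap, tendsto_map'_iff]
    exact (isProperMap_iff_tendsto_cocompact.1 hproper).2.mono_left
      (comap_cocompact_le continuous_subtype_val)
  have hnorm : Tendsto (fun p => Real.cos (2 * α) * ‖X p‖ ^ 2) (cocompact S ⊓ 𝓟 M) atTop :=
    ((tendsto_pow_atTop two_ne_zero).comp
      (tendsto_norm_cocompact_atTop.comp hX)).const_mul_atTop hα
  obtain ⟨K, -, hK, hKcone⟩ := hcone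
  refine tendsto_atTop_mono' _ ?_ hnorm
  filter_upwards [mem_inf_of_left hK.compl_mem_cocompact, mem_inf_of_right (mem_principal_self M)]
    with p hpK hpM
  exact cos_two_mul_mul_norm_sq_le_lorentz hcos (hKcone p ⟨hpM, hpK⟩)

theorem mainTheorem5_general {S : Type*} [TopologicalSpace S] [ConnectedSpace S]
    [ChartedSpace ℂ S] {M B : Set S} (hM : IsSurfaceWithBoundary M B) (hB : B.Nonempty)
    {X : S → EuclideanSpace ℝ (Fin 3)} (hX : IsConformalMaximalImmersion M B X)
    (hlorentz : Tendsto (fun p => lorentz (X p) (X p)) (cocompact S ⊓ 𝓟 M) atTop) :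
    IsRelativeParabolic M B := by
  obtain ⟨K, hK, hKlt⟩ :=
    mem_cocompact.1 (eventually_inf_principal.1 (hlorentz.eventually_gt_atTop 1))
  refine isRelativeParabolic_of_strictlySuperharmonic hM hB (hK.inter_right hM.isClosed)
    Set.inter_subset_right (continuous_lorentzBarrier.comp_continuousOn hX.continuousOn) ?_
    (tendsto_logSubInv_atTop.comp (tendsto_atTop_mono (fun p => le_max_right 1 _) hlorentz))
  rintro p ⟨hpM, hpBK⟩
  refine hX.isStrictlySuperharmonicOnSurface_lorentzBarrier hM p ⟨⟨hpM, ?_⟩, ?_⟩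
  · exact fun hpB => hpBK (Or.inl hpB)
  · exact hKlt (fun hpK => hpBK (Or.inr ⟨hpK, hpM⟩)) hpM

theorem mainTheorem5 {S : Type*} [TopologicalSpace S] [T2Space S] [ConnectedSpace S]
    [ChartedSpace ℂ S] [IsManifold 𝓘(ℂ) ω S]
    (M B : Set S) (hM : IsSurfaceWithBoundary M B) (hB : B.Nonempty)
    (X : S → EuclideanSpace ℝ (Fin 3)) (hX : IsConformalMaximalImmersion M B X)
    (hproper : IsProperMap (M.domRestrict X))
    (α : ℝ) (hα : α ∈ Set.Ioo 0 (Real.pi / 4))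
    (hcone : EventuallyOn M (fun p => X p ∈ conicalRegion α)) :
    IsRelativeParabolic M B := by
  exact mainTheorem5_general hM hB hX
    (tendsto_lorentz_self_atTop hproper
      (Real.cos_pos_of_mem_Ioo ⟨by linarith [hα.1, Real.pi_pos], by linarith [hα.2]⟩) hcone)
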